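/- Let $\mathcal N$ be a model (of arbitrary cardinality) of first-order Peano arithmetic $\mathsf{PA}$, formulated in the language $\{0,1,+,\times,<\}$, with domain $N$. For an element $a$ of a structure $\mathcal A$, let $\mathrm{dcl}^{\mathcal A}(a)$ be the set of elements that are definable in $\mathcal A$ by a first-order formula with parameter $a$. A set $X\subseteq N$ is a *class* of $\mathcal N$ if for every $a\in N$ the set $\{x\in X:\mathcal N\models x<a\}$ is definable in $\mathcal N$ with parameters; it is *neutral* if $\mathrm{dcl}^{\mathcal N}(a)=\mathrm{dcl}^{(\mathcal N,X)}(a)$ for every $a\in N$, where $(\mathcal N,X)$ is the expansion of $\mathcal N$ by a unary predicate for $X$; and it is *0-definable* if it is definable in $\mathcal N$ without parameters. A *neutral class* is a class that is neutral, and $\mathcal N$ is *neutrally expandable* if it has a neutral class that is not definable in $\mathcal N$ with parameters. A model $\mathcal M$ of $\mathsf{PA}$ is *recursively saturated* if for every finite tuple $\bar a$ from its domain and every recursive set $p(x,\bar y)$ of formulas such that $p(x,\bar a)$ is finitely satisfiable in $\mathcal M$, some element of $\mathcal M$ realizes $p(x,\bar a)$. If $\mathcal N$ has a recursively saturated elementary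 submodel, then for every class $X$ of $\mathcal N$: $X$ is a neutral class if and only if $X$ is 0-definable in $\mathcal N$. In particular, if $\mathcal N$ is recursively saturated, then $\mathcal N$ is not neutrally expandable. -/

import Mathlib

open FirstOrder

namespace PAModels

open FirstOrder.Language

/-! ### The language and the theory PA -/

/-- The function symbols `0, 1, +, *`. -/
inductive PAFunc : ℕ → Type
  | zero : PAFunc 0
  | one : PAFunc 0
  | add : PAFunc 2
  | mul : PAFunc 2

/-- The relation symbol `<`. -/
inductive PARel : ℕ → Type
  | lt : PARel 2

/-- The language `{0, 1, +, *, <}` of Peano arithmetic. -/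
abbrev LPA : FirstOrder.Language.{0, 0} := ⟨PAFunc, PARel⟩

section Terms

variable {α : Type*}

instance : Zero (LPA.Term α) := ⟨Constants.term (L := LPA) PAFunc.zero⟩
instance : One (LPA.Term α) := ⟨Constants.term (L := LPA) PAFunc.one⟩
instance : Add (LPA.Term α) := ⟨Functions.apply₂ (L := LPA) PAFunc.add⟩
instance : Mul (LPA.Term α) := ⟨Functions.apply₂ (L := LPA) PAFunc.mul⟩

/-- The atomic formula `s < t`. -/
def ltFormula {n : ℕ} (s t : LPA.Term (α ⊕ Fin n)) : LPA.BoundedFormula α n :=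
  Relations.boundedFormula₂ (L := LPA) PARel.lt s t

end Terms

/-- `x + 1 ≠ 0`. -/
def axSuccNeZero : LPA.Sentence := ∀' ∼((&0 + 1) =' 0)

/-- `x + 1 = y + 1 → x = y`. -/
def axSuccInj : LPA.Sentence := ∀' ∀' (((&0 + 1) =' (&1 + 1)) ⟹ (&0 =' &1))

/-- `x + 0 = x`. -/
def axAddZero : LPA.Sentence := ∀' ((&0 + 0) =' &0)

/-- `x + (y + 1) = (x + y) + 1`. -/
def axAddSucc : LPA.Sentence := ∀' ∀' ((&0 + (&1 + 1)) =' ((&0 + &1) + 1))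

/-- `x * 0 = 0`. -/
def axMulZero : LPA.Sentence := ∀' ((&0 * 0) =' 0)

/-- `x * (y + 1) = x * y + x`. -/
def axMulSucc : LPA.Sentence := ∀' ∀' ((&0 * (&1 + 1)) =' ((&0 * &1) + &0))

/-- `x < y ↔ ∃ z, x + (z + 1) = y`. -/
def axLt : LPA.Sentence := ∀' ∀' ((ltFormula &0 &1) ⇔ (∃' ((&0 + (&2 + 1)) =' &1)))

/-- A formula whose free variables are `Fin k`, with these variables made ready to be
quantified. -/
def openVars {k : ℕ} (φ : LPA.Formula (Fin k)) : LPA.BoundedFormula Empty k :=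
  BoundedFormula.relabel (k := 0) (Sum.inr : Fin k → Empty ⊕ Fin k) φ

/-- The induction axiom for `φ(y₀, …, yₙ₋₁, x)`: the universal closure of
`φ(y, 0) → ∀ x, (φ(y, x) → φ(y, x + 1)) → ∀ x, φ(y, x)`; the induction variable `x` is the last
one. -/
def inductionAxiom {n : ℕ} (φ : LPA.Formula (Fin (n + 1))) : LPA.Sentence :=
  ((openVars (φ.subst (Fin.snoc (α := fun _ => LPA.Term (Fin n)) Term.var 0))) ⟹
    ((∀' ((openVars φ) ⟹
        (openVars (φ.subst (Fin.snoc (α := fun _ => LPA.Term (Fin (n + 1)))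
          (fun i => Term.var i.castSucc) (Term.var (Fin.last n) + 1)))))) ⟹
      (∀' (openVars φ)))).alls

/-- First-order Peano arithmetic. -/
def PA : LPA.Theory :=
  {axSuccNeZero, axSuccInj, axAddZero, axAddSucc, axMulZero, axMulSucc, axLt} ∪
    {σ | ∃ (n : ℕ) (φ : LPA.Formula (Fin (n + 1))), σ = inductionAxiom φ}

/-! ### Gödel numbers and recursive saturation -/

/-- The Gödel number of a term with free variables in `Fin m` and bound variables in `Fin n`. -/
def codeTerm {m n : ℕ} : LPA.Term (Fin m ⊕ Fin n) → ℕ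
  | .var (.inl i) => Nat.pair 0 i
  | .var (.inr i) => Nat.pair 1 i
  | .func PAFunc.zero _ => Nat.pair 2 0
  | .func PAFunc.one _ => Nat.pair 3 0
  | .func PAFunc.add ts => Nat.pair 4 (Nat.pair (codeTerm (ts 0)) (codeTerm (ts 1)))
  | .func PAFunc.mul ts => Nat.pair 5 (Nat.pair (codeTerm (ts 0)) (codeTerm (ts 1)))

/-- The Gödel number of a formula. -/
def codeFormula {m : ℕ} : {n : ℕ} → LPA.BoundedFormula (Fin m) n → ℕ
  | _, .falsum => Nat.pair 0 0
  | _, .equal s t => Nat.pair 1 (Nat.pair (codeTerm s) (codeTerm t))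
  | _, .rel PARel.lt ts => Nat.pair 2 (Nat.pair (codeTerm (ts 0)) (codeTerm (ts 1)))
  | _, .imp φ ψ => Nat.pair 3 (Nat.pair (codeFormula φ) (codeFormula ψ))
  | _, .all φ => Nat.pair 4 (codeFormula φ)

/-- A set of formulas is recursive if the set of its Gödel numbers is. -/
def IsRecursive {m : ℕ} (p : Set (LPA.Formula (Fin m))) : Prop :=
  ComputablePred fun k : ℕ => ∃ φ ∈ p, codeFormula φ = k

section Models

variable (M : Type*) [LPA.Structure M]

/-- `M` is recursively saturated: for every finite tuple `a` of parameters and every recursive set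
`p(x, y)` of formulas, if `p(x, a)` is finitely satisfiable in `M`, then some element of `M`
realizes `p(x, a)`. -/
def RecursivelySaturated : Prop :=
  ∀ (n : ℕ) (a : Fin n → M) (p : Set (LPA.Formula (Fin (n + 1)))), IsRecursive p →
    (∀ s : Finset (LPA.Formula (Fin (n + 1))), (s : Set (LPA.Formula (Fin (n + 1)))) ⊆ p →
      ∃ x : M, ∀ φ ∈ s, φ.Realize (Fin.cons x a : Fin (n + 1) → M)) →
    ∃ x : M, ∀ φ ∈ p, φ.Realize (Fin.cons x a : Fin (n + 1) → M)

/-! ### Classes and neutral sets -/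

variable {M}

/-- The order of `M`. -/
def lt (x y : M) : Prop := Structure.RelMap (L := LPA) PARel.lt ![x, y]

/-- `X` is definable in `M`, with parameters from `M`. -/
def IsDefinable (X : Set M) : Prop := (Set.univ : Set M).Definable₁ LPA X

/-- `X` is `0`-definable in `M`: definable without parameters. -/
def IsZeroDefinable (X : Set M) : Prop := (∅ : Set M).Definable₁ LPA X

/-- `X` is a class of `M`: every proper initial part of `X` is definable, with parameters. -/
def IsClass (X : Set M) : Prop := ∀ a : M, IsDefinable {x | x ∈ X ∧ lt x a}

/-- The relation symbol of a language with one unary relation symbol. -/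
inductive UnaryRel : ℕ → Type
  | pred : UnaryRel 1

/-- The language with one unary relation symbol. -/
abbrev LUnary : FirstOrder.Language.{0, 0} := ⟨fun _ => Empty, UnaryRel⟩

/-- `X` as the interpretation of the unary relation symbol. -/
@[reducible] def unaryStructure (X : Set M) : LUnary.Structure M where
  funMap := fun f => nomatch f
  RelMap := fun {_} r => match r with
    | UnaryRel.pred => fun v => v 0 ∈ X

/-- The definable closure of `a`: the elements definable by an `L`-formula with parameter `a`. -/
def dcl (L : FirstOrder.Language.{0, 0}) {M : Type*} [L.Structure M] (a : M) : Set M :=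
  {b | ({a} : Set M).Definable₁ L {b}}

/-- The definable closure of `a` in the expansion `(M, X)`. -/
def dclExpansion (X : Set M) (a : M) : Set M :=
  letI := unaryStructure X
  dcl (LPA.sum LUnary) a

/-- `X` is neutral: `M` and `(M, X)` have the same definable closures of elements. -/
def IsNeutral (X : Set M) : Prop := ∀ a : M, dcl LPA a = dclExpansion X a

/-- `X` is a neutral class of `M`. -/
def IsNeutralClass (X : Set M) : Prop := IsClass X ∧ IsNeutral X

variable (M) in
/-- `M` is neutrally expandable: it has an undefinable neutral class. -/
def NeutrallyExpandable : Prop := ∃ X : Set M, IsNeutralClass X ∧ ¬ IsDefinable X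

end Models

end PAModels

/-! Let X be a neutral class. If a nonempty set is definable in (N,X) over a and its part up to some
element of it is definable in N, then it has a least element. This element lies in the closure of a
in (N,X), hence, by neutrality, in the closure of a in N (`exists_mem_dcl`). Choosing the parameters
in a definition of X below a one at a time in this way, one sees that X below a is definable over a
alone (`IsClass.definable_singleton`). In the same way X is 0-definable as soon as it is definable
with parameters (`isZeroDefinable_of_isDefinable`).

Saturation makes these definitions uniform. A recursively saturated elementary submodel contains
some u above all 0-definable elements (`exists_gt_definable`). Finitely many formulas define X below
a over a for all a < u: otherwise the submodel would contain some a < u at which every formula fails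
(`exists_finite_formulas`). If these finitely many formulas failed anywhere in N, the least failure
would be 0-definable, hence below u, a contradiction.

So X is a branch of a definable tree of finite width. Such a branch is isolated: sufficiently long
nodes that agree with it on a suitable initial part agree with it as far as desired
(`exists_branch_description`). As this initial part is definable, so is X
(`IsClass.isDefinable_of_finite_width`), and then X is 0-definable.

Conversely, a 0-definable predicate can be replaced by its definition in every formula, so it adds
no definable elements. -/

namespace PAModels

open FirstOrder.Language Set

/-! ### Closure properties of definable sets -/

section Definability

variable {L : FirstOrder.Language} {M : Type*} [L.Structure M] {A : Set M} {α β : Type*}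

theorem definable_congr {P Q : (α → M) → Prop} (h : A.Definable L {v | P v})
    (hPQ : ∀ v, P v ↔ Q v) : A.Definable L {v | Q v} := by
  simpa only [hPQ] using h

theorem definable_not {P : (α → M) → Prop} (h : A.Definable L {v | P v}) :
    A.Definable L {v | ¬ P v} := h.compl

theorem definable_and {P Q : (α → M) → Prop} (hP : A.Definable L {v | P v})
    (hQ : A.Definable L {v | Q v}) : A.Definable L {v | P v ∧ Q v} := hP.inter hQ

theorem definable_imp {P Q : (α → M) → Prop} (hP : A.Definable L {v | P v})
    (hQ : A.Definable L {v | Q v}) : A.Definable L {v | P v → Q v} := by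
  have : {v | P v → Q v} = {v | P v}ᶜ ∪ {v | Q v} := by
    ext v; simp [imp_iff_not_or]
  rw [this]
  exact hP.compl.union hQ

theorem definable_iff {P Q : (α → M) → Prop} (hP : A.Definable L {v | P v})
    (hQ : A.Definable L {v | Q v}) : A.Definable L {v | P v ↔ Q v} := by
  simp only [iff_iff_implies_and_implies]
  exact definable_and (definable_imp hP hQ) (definable_imp hQ hP)

/-- `Option α` is the set of variables with one more adjoined; `none` is the quantified variable. -/
theorem definable_ex [Finite α] {P : (α → M) → M → Prop}
    (h : A.Definable L {w : Option α → M | P (fun i => w (some i)) (w none)}) :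
    A.Definable L {v | ∃ y, P v y} := by
  have := h.image_comp (some : α → Option α)
  convert this using 1
  ext v
  simp only [mem_ofPred_eq, mem_image]
  constructor
  · rintro ⟨y, hy⟩
    exact ⟨fun o => o.elim y v, hy, rfl⟩
  · rintro ⟨w, hw, rfl⟩
    exact ⟨_, hw⟩

theorem definable_all [Finite α] {P : (α → M) → M → Prop}
    (h : A.Definable L {w : Option α → M | P (fun i => w (some i)) (w none)}) :
    A.Definable L {v | ∀ y, P v y} := by
  have := definable_not (definable_ex (P := fun v y => ¬ P v y) (definable_not h))
  simpa using this

theorem definable_ex_tuple [Finite β] {P : (α → M) → (β → M) → Prop}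
    (h : A.Definable L {w : α ⊕ β → M | P (fun i => w (.inl i)) (fun i => w (.inr i))}) :
    A.Definable L {v | ∃ y, P v y} :=
  h.exists_of_finite

theorem definable_finite_all {ι : Type*} [Finite ι] {P : ι → (α → M) → Prop}
    (h : ∀ i, A.Definable L {v | P i v}) : A.Definable L {v | ∀ i, P i v} := by
  convert definable_iInter_of_finite h using 1
  ext v; simp

theorem definable_finite_ex {ι : Type*} [Finite ι] {P : ι → (α → M) → Prop}
    (h : ∀ i, A.Definable L {v | P i v}) : A.Definable L {v | ∃ i, P i v} := by
  convert definable_iUnion_of_finite h using 1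
  ext v; simp

theorem definable_mem {S : Set M} (h : A.Definable₁ L S) (i : α) :
    A.Definable L {v : α → M | v i ∈ S} :=
  h.preimage_comp (fun _ : Fin 1 => i)

theorem definable_realize {n : ℕ} (φ : L.BoundedFormula β n) (f : β → α) (g : Fin n → α) :
    A.Definable L {v : α → M | φ.Realize (fun i => v (f i)) (fun i => v (g i))} := by
  refine (empty_definable_iff.2 ⟨φ.toFormula.relabel (Sum.elim f g), ?_⟩).mono (empty_subset A)
  ext v
  simp only [mem_ofPred_eq, Formula.realize_relabel, BoundedFormula.realize_toFormula]
  rfl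

theorem definable_eq (i j : α) : A.Definable L {v : α → M | v i = v j} := by
  have := definable_realize (A := A) (M := M) ((&0 : L.Term (Empty ⊕ Fin 2)) =' &1)
    (fun e => e.elim) ![i, j]
  simpa using this

/-- An element that is definable over `A` may be used as a parameter. -/
theorem definable_subst [Finite α] {P : (α → M) → M → Prop} {a : M} (ha : A.Definable₁ L {a})
    (h : A.Definable L {w : Option α → M | P (fun i => w (some i)) (w none)}) :
    A.Definable L {v | P v a} := by
  have := definable_ex (P := fun v y => y ∈ ({a} : Set M) ∧ P v y)
    (definable_and (definable_mem ha none) h)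
  simpa using this

theorem definable_subst_tuple [Finite β] {P : (α → M) → (β → M) → Prop} {p : β → M}
    (hp : ∀ i, A.Definable₁ L {p i})
    (h : A.Definable L {w : α ⊕ β → M | P (fun i => w (.inl i)) (fun i => w (.inr i))}) :
    A.Definable L {v | P v p} := by
  have := definable_ex_tuple (P := fun v y => (∀ i, y i ∈ ({p i} : Set M)) ∧ P v y)
    (definable_and (definable_finite_all fun i => definable_mem (hp i) (Sum.inr i)) h)
  simpa [← funext_iff] using this

theorem definable_const [Finite α] {P : (α → M) → M → Prop} (a : M)
    (h : (univ : Set M).Definable L {w : Option α → M | P (fun i => w (some i)) (w none)}) :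
    (univ : Set M).Definable L {v | P v a} :=
  definable_subst (Definable.singleton_of_mem L (mem_univ a)) h

theorem exists_formula_fin_params {s : Set (α → M)} (h : A.Definable L s) :
    ∃ (n : ℕ) (p : Fin n → M) (φ : L.Formula (Fin n ⊕ α)),
      (∀ i, p i ∈ A) ∧ s = {v | φ.Realize (Sum.elim p v)} := by
  obtain ⟨A₀, hA, h⟩ := definable_iff_finitely_definable.1 h
  obtain ⟨φ, rfl⟩ := definable_iff_exists_formula_sum.1 h
  let e := A₀.equivFin
  refine ⟨_, fun i => (e.symm i : M), φ.relabel (Sum.map e id), fun i => hA (e.symm i).2, ?_⟩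
  ext v
  simp only [mem_ofPred_eq, Formula.realize_relabel]
  refine iff_of_eq (congrArg _ ?_)
  funext i
  rcases i with i | i
  · simp
  · simp

/-- A set that is definable over one element is given by a formula in two variables. -/
theorem exists_formula_of_definable_singleton {a : M} {s : Set M}
    (h : ({a} : Set M).Definable₁ L s) :
    ∃ φ : L.BoundedFormula (Fin 1) 1, ∀ x, φ.Realize (fun _ => a) (fun _ => x) ↔ x ∈ s := by
  obtain ⟨φ, hφ⟩ := definable_iff_exists_formula_sum.1 h
  refine ⟨BoundedFormula.relabel (n := 1) (k := 0)
    (Sum.elim (fun _ => Sum.inl 0) Sum.inr) φ, fun x => ?_⟩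
  have := Set.ext_iff.1 hφ (fun _ => x)
  simp only [mem_ofPred_eq] at this
  rw [this, BoundedFormula.realize_relabel, Formula.Realize]
  refine iff_of_eq (congrArg₂ _ ?_ (Subsingleton.elim _ _))
  funext i
  rcases i with ⟨i, rfl⟩ | i <;> rfl

theorem exists_formula_of_definable_empty {s : Set M} (h : (∅ : Set M).Definable₁ L s) :
    ∃ φ : L.BoundedFormula (Fin 0) 1, ∀ x, φ.Realize Fin.elim0 (fun _ => x) ↔ x ∈ s := by
  obtain ⟨φ, hφ⟩ := empty_definable_iff.1 h
  refine ⟨BoundedFormula.relabel (n := 1) (k := 0) Sum.inr φ, fun x => ?_⟩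
  have := Set.ext_iff.1 hφ (fun _ => x)
  simp only [mem_ofPred_eq] at this
  rw [this, BoundedFormula.realize_relabel, Formula.Realize]
  exact iff_of_eq (congrArg₂ _ rfl (Subsingleton.elim _ _))

end Definability

/-! ### Order and induction in models of PA -/

section Arithmetic

variable {M : Type*} [LPA.Structure M]

/-- The interpretation of `0`. -/
def zeroElem (M : Type*) [LPA.Structure M] : M := Structure.funMap (L := LPA) PAFunc.zero ![]

/-- The interpretation of `1`. -/
def oneElem (M : Type*) [LPA.Structure M] : M := Structure.funMap (L := LPA) PAFunc.one ![]

/-- The interpretation of `+`. -/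
def addElem (x y : M) : M := Structure.funMap (L := LPA) PAFunc.add ![x, y]

/-- The successor function. -/
def succElem (x : M) : M := addElem x (oneElem M)

variable {α : Type*} {n : ℕ}

theorem realize_zero (v : α → M) : (0 : LPA.Term α).realize v = zeroElem M :=
  congrArg (Structure.funMap (L := LPA) PAFunc.zero) (Subsingleton.elim _ _)

theorem realize_one (v : α → M) : (1 : LPA.Term α).realize v = oneElem M :=
  congrArg (Structure.funMap (L := LPA) PAFunc.one) (Subsingleton.elim _ _)

theorem realize_add (s t : LPA.Term α) (v : α → M) :
    (s + t).realize v = addElem (s.realize v) (t.realize v) :=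
  Term.realize_functions_apply₂

theorem realize_lt (s t : LPA.Term (α ⊕ Fin n)) (v : α → M) (xs : Fin n → M) :
    (ltFormula s t).Realize v xs ↔ lt (s.realize (Sum.elim v xs)) (t.realize (Sum.elim v xs)) :=
  BoundedFormula.realize_rel₂

theorem definable_lt {A : Set M} (i j : α) : A.Definable LPA {v : α → M | lt (v i) (v j)} := by
  have := definable_realize (A := A) (M := M)
    (ltFormula (&0 : LPA.Term (Empty ⊕ Fin 2)) &1) (fun e => e.elim) ![i, j]
  simpa [realize_lt] using this

theorem definable_eq_zero {A : Set M} (i : α) : A.Definable LPA {v : α → M | v i = zeroElem M} := by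
  have := definable_realize (A := A) (M := M)
    ((&0 : LPA.Term (Empty ⊕ Fin 1)) =' 0) (fun e => e.elim) ![i]
  simpa [realize_zero] using this

theorem definable_add {A : Set M} (i j k : α) :
    A.Definable LPA {v : α → M | addElem (v i) (v j) = v k} := by
  have := definable_realize (A := A) (M := M)
    ((&0 + &1 : LPA.Term (Empty ⊕ Fin 3)) =' &2) (fun e => e.elim) ![i, j, k]
  simpa [realize_add] using this

theorem definable_succ {A : Set M} (i j : α) :
    A.Definable LPA {v : α → M | succElem (v i) = v j} := by
  have := definable_realize (A := A) (M := M)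
    ((&0 + 1 : LPA.Term (Empty ⊕ Fin 2)) =' &1) (fun e => e.elim) ![i, j]
  simpa [realize_add, realize_one, succElem] using this

theorem realize_openVars {k : ℕ} (φ : LPA.Formula (Fin k)) (v : Empty → M) (xs : Fin k → M) :
    (openVars φ).Realize v xs ↔ φ.Realize xs :=
  Formula.realize_relabel_sumInr φ

section

variable (hM : M ⊨ PA)

include hM

theorem realize_axiom {σ : LPA.Sentence}
    (h : σ ∈ ({axSuccNeZero, axSuccInj, axAddZero, axAddSucc, axMulZero, axMulSucc, axLt} :
      Set LPA.Sentence)) : M ⊨ σ :=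
  hM.realize_of_mem σ (Or.inl h)

theorem succ_ne_zero (x : M) : succElem x ≠ zeroElem M := by
  have := realize_axiom hM (σ := axSuccNeZero) (by simp)
  simp [axSuccNeZero, Sentence.Realize, Formula.Realize, realize_add, realize_one, realize_zero,
    Fin.snoc] at this
  exact this x

theorem succ_inj {x y : M} (h : succElem x = succElem y) : x = y := by
  have := realize_axiom hM (σ := axSuccInj) (by simp)
  simp [axSuccInj, Sentence.Realize, Formula.Realize, realize_add, realize_one, 
    Fin.snoc] at this
  exact this x y h

theorem add_zero' (x : M) : addElem x (zeroElem M) = x := by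
  have := realize_axiom hM (σ := axAddZero) (by simp)
  simp [axAddZero, Sentence.Realize, Formula.Realize, realize_add, realize_zero, 
    Fin.snoc] at this
  exact this x

theorem add_succ' (x y : M) : addElem x (succElem y) = succElem (addElem x y) := by
  have := realize_axiom hM (σ := axAddSucc) (by simp)
  simp [axAddSucc, Sentence.Realize, Formula.Realize, realize_add, realize_one, 
    Fin.snoc] at this
  exact this x y

theorem lt_iff (x y : M) : lt x y ↔ ∃ z, addElem x (succElem z) = y := by
  have := realize_axiom hM (σ := axLt) (by simp)
  simp [axLt, Sentence.Realize, Formula.Realize, realize_add, realize_one, realize_lt,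
    Fin.snoc] at this
  exact this x y

/-- Induction for sets that are definable with parameters. -/
theorem definable_induction {P : M → Prop} (hP : (univ : Set M).Definable₁ LPA {x | P x})
    (h0 : P (zeroElem M)) (hs : ∀ x, P x → P (succElem x)) (x : M) : P x := by
  obtain ⟨n, p, φ, -, hφ⟩ := exists_formula_fin_params hP
  -- The parameters become the variables y of the induction axiom, and x comes last.
  have key : ∀ x, P x ↔ (φ.relabel finSumFinEquiv : LPA.Formula (Fin (n + 1))).Realize
      (Fin.snoc p x : Fin (n + 1) → M) := fun x => by
    have := Set.ext_iff.1 hφ (fun _ => x)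
    simp only [mem_ofPred_eq] at this
    rw [this, Formula.realize_relabel]
    refine iff_of_eq (congrArg _ ?_)
    funext i
    rcases i with i | i
    · exact (Fin.snoc_castSucc (α := fun _ => M) x p i).symm
    · have : i = 0 := Subsingleton.elim _ _
      subst this
      exact (Fin.snoc_last (α := fun _ => M) x p).symm
  generalize (φ.relabel finSumFinEquiv : LPA.Formula (Fin (n + 1))) = ψ at key
  have ax : M ⊨ inductionAxiom ψ := hM.realize_of_mem _ (Or.inr ⟨n, ψ, rfl⟩)
  rw [inductionAxiom, Sentence.Realize, BoundedFormula.realize_alls] at ax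
  have := ax p
  simp only [BoundedFormula.realize_imp, BoundedFormula.realize_all, realize_openVars] at this
  rw [key]
  refine this ?_ (fun x hx => ?_) x
  · rw [Formula.Realize, BoundedFormula.realize_subst]
    rw [key] at h0
    refine (iff_of_eq (congrArg₂ _ ?_ rfl)).1 h0
    funext i
    refine Fin.lastCases ?_ (fun i => ?_) i
    · simp [realize_zero]
    · simp
  · rw [Formula.Realize, BoundedFormula.realize_subst]
    have h1 := (key _).1 (hs x ((key x).2 hx))
    refine (iff_of_eq (congrArg₂ _ ?_ rfl)).1 h1
    funext i
    refine Fin.lastCases ?_ (fun i => ?_) i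
    · simp [realize_add, realize_one, succElem]
    · simp

theorem zero_add' (x : M) : addElem (zeroElem M) x = x := by
  refine definable_induction hM (P := fun x => addElem (zeroElem M) x = x)
    (definable_const (P := fun v z => addElem z (v 0) = v 0) _ (definable_add _ _ _))
    (add_zero' hM _) (fun x hx => ?_) x
  rw [add_succ' hM, hx]

theorem succ_add' (x y : M) : addElem (succElem x) y = succElem (addElem x y) := by
  refine definable_induction hM (P := fun y => addElem (succElem x) y = succElem (addElem x y))
    ?_ ?_ (fun y hy => ?_) y
  · refine definable_const (P := fun v x => addElem (succElem x) (v 0) = succElem (addElem x (v 0)))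
      _ ?_
    -- Only the graphs of the operations are known to be definable, so each intermediate value is
    -- named by a quantifier.
    have : (univ : Set M).Definable LPA {w : Option (Fin 1) → M | ∃ s, succElem (w none) = s ∧
        ∃ r, addElem (w none) (w (some 0)) = r ∧ ∃ t, addElem s (w (some 0)) = t ∧
          succElem r = t} :=
      definable_ex <| definable_and (definable_succ _ _) <| definable_ex <|
        definable_and (definable_add _ _ _) <| definable_ex <|
        definable_and (definable_add _ _ _) <| definable_succ _ _
    simpa [eq_comm] using this
  · rw [add_zero' hM, add_zero' hM]
  · rw [add_succ' hM, hy, add_succ' hM]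

theorem add_assoc' (x y z : M) : addElem (addElem x y) z = addElem x (addElem y z) := by
  refine definable_induction hM (P := fun z => addElem (addElem x y) z = addElem x (addElem y z))
    ?_ ?_ (fun z hz => ?_) z
  · refine definable_const (P := fun v x => addElem (addElem x y) (v 0) =
      addElem x (addElem y (v 0))) _ ?_
    refine definable_const (P := fun v y => addElem (addElem (v none) y) (v (some 0)) =
      addElem (v none) (addElem y (v (some 0)))) _ ?_
    have : (univ : Set M).Definable LPA {w : Option (Option (Fin 1)) → M |
        ∃ s, addElem (w (some none)) (w none) = s ∧
        ∃ r, addElem (w none) (w (some (some 0))) = r ∧ ∃ t, addElem s (w (some (some 0))) = t ∧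
          addElem (w (some none)) r = t} :=
      definable_ex <| definable_and (definable_add _ _ _) <| definable_ex <|
        definable_and (definable_add _ _ _) <| definable_ex <|
        definable_and (definable_add _ _ _) <| definable_add _ _ _
    simpa [eq_comm] using this
  · rw [add_zero' hM, add_zero' hM]
  · rw [add_succ' hM, hz, add_succ' hM, add_succ' hM]

theorem eq_zero_or_succ (x : M) : x = zeroElem M ∨ ∃ y, x = succElem y := by
  refine definable_induction hM (P := fun x => x = zeroElem M ∨ ∃ y, x = succElem y)
    ?_ (Or.inl rfl) (fun x _ => Or.inr ⟨x, rfl⟩) x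
  refine (definable_eq_zero (M := M) (A := univ) (0 : Fin 1)).union ?_
  refine definable_ex (P := fun v y => v 0 = succElem y) ?_
  simpa only [eq_comm] using definable_succ _ _

theorem lt_succ_self (x : M) : lt x (succElem x) :=
  (lt_iff hM _ _).2 ⟨zeroElem M, by rw [add_succ' hM, add_zero' hM]⟩

theorem lt_trans' {x y z : M} (h : lt x y) (h' : lt y z) : lt x z := by
  obtain ⟨a, rfl⟩ := (lt_iff hM _ _).1 h
  obtain ⟨b, rfl⟩ := (lt_iff hM _ _).1 h'
  exact (lt_iff hM _ _).2 ⟨addElem (succElem a) b, by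
    rw [add_assoc' hM, add_succ' hM (succElem a)]⟩

theorem lt_irrefl' (x : M) : ¬ lt x x := by
  rw [lt_iff hM]
  rintro ⟨z, hz⟩
  refine definable_induction hM (P := fun x => ¬ addElem x (succElem z) = x) ?_ ?_ ?_ x hz
  · exact definable_const (P := fun v z => ¬ addElem (v 0) z = v 0) _
      (definable_not (definable_add _ _ _))
  · rw [zero_add' hM]
    exact succ_ne_zero hM z
  · intro x hx h
    rw [succ_add' hM] at h
    exact hx (succ_inj hM h)

theorem not_lt_zero (x : M) : ¬ lt x (zeroElem M) := by
  rw [lt_iff hM]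
  rintro ⟨z, hz⟩
  rw [add_succ' hM] at hz
  exact succ_ne_zero hM _ hz

theorem lt_succ_iff {x y : M} : lt x (succElem y) ↔ lt x y ∨ x = y := by
  refine ⟨fun h => ?_, ?_⟩
  · obtain ⟨z, hz⟩ := (lt_iff hM _ _).1 h
    rw [add_succ' hM] at hz
    have hz := succ_inj hM hz
    rcases eq_zero_or_succ hM z with rfl | ⟨w, rfl⟩
    · rw [add_zero' hM] at hz
      exact Or.inr hz
    · exact Or.inl ((lt_iff hM _ _).2 ⟨w, hz⟩)
  · rintro (h | rfl)
    · exact lt_trans' hM h (lt_succ_self hM y)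
    · exact lt_succ_self hM x

theorem lt_trichotomy' (x y : M) : lt x y ∨ x = y ∨ lt y x := by
  refine definable_induction hM (P := fun x => lt x y ∨ x = y ∨ lt y x) ?_ ?_ ?_ x
  · exact definable_const (P := fun v y => lt (v 0) y ∨ v 0 = y ∨ lt y (v 0)) _
      ((definable_lt _ _).union ((definable_eq _ _).union (definable_lt _ _)))
  · rcases eq_zero_or_succ hM y with rfl | ⟨w, rfl⟩
    · exact Or.inr (Or.inl rfl)
    · exact Or.inl ((lt_iff hM _ _).2 ⟨w, zero_add' hM _⟩)
  · rintro x (h | rfl | h)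
    · obtain ⟨z, rfl⟩ := (lt_iff hM _ _).1 h
      rcases eq_zero_or_succ hM z with rfl | ⟨w, rfl⟩
      · exact Or.inr (Or.inl (by rw [add_succ' hM, add_zero' hM]))
      · exact Or.inl ((lt_iff hM _ _).2 ⟨w, by rw [succ_add' hM, add_succ' hM x (succElem w)]⟩)
    · exact Or.inr (Or.inr (lt_succ_self hM _))
    · exact Or.inr (Or.inr (lt_trans' hM h (lt_succ_self hM _)))

/-- The least number principle for sets that are definable with parameters. -/
theorem exists_least {P : M → Prop} (hP : (univ : Set M).Definable₁ LPA {x | P x}) {a : M}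
    (ha : P a) : ∃ b, P b ∧ ∀ x, lt x b → ¬ P x := by
  by_contra! hcon
  refine definable_induction hM (P := fun x => ∀ y, lt y x → ¬ P y) ?_ ?_ ?_ (succElem a) a
    (lt_succ_self hM a) ha
  · exact definable_all (P := fun v y => lt y (v 0) → ¬ P y) <|
      definable_imp (definable_lt _ _) (definable_not (definable_mem hP none))
  · exact fun y hy => absurd hy (not_lt_zero hM y)
  · intro x hx y hy hPy
    rcases (lt_succ_iff hM).1 hy with h | rfl
    · exact hx y h hPy
    · obtain ⟨z, hz, hPz⟩ := hcon y hPy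
      exact hx z hz hPz

end

end Arithmetic

/-! ### Consequences of neutrality -/

section Neutral

variable {N : Type*} [LPA.Structure N] {X : Set N} {A : Set N} {α : Type*}

/-- Definability in the expansion by a unary predicate. -/
def DefinableIn (X : Set N) (A : Set N) (s : Set (α → N)) : Prop :=
  letI := unaryStructure X
  A.Definable (LPA.sum LUnary) s

theorem DefinableIn.of_definable {s : Set (α → N)} (h : A.Definable LPA s) :
    DefinableIn X A s := by
  let := unaryStructure X
  exact h.map_expansion (L' := LPA.sum LUnary) LHom.sumInl

theorem definableIn_mem (i : α) : DefinableIn X A {v : α → N | v i ∈ X} := by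
  let := unaryStructure X
  have := definable_realize (A := A) (L := LPA.sum LUnary) (M := N) (β := Empty)
    (Relations.boundedFormula₁ (L := LPA.sum LUnary) (Sum.inr UnaryRel.pred) &0)
    (fun e => e.elim) ![i]
  exact definable_congr this fun v => Iff.rfl

omit [LPA.Structure N] in
theorem definable_cons_tuple {L : FirstOrder.Language} [L.Structure N] {n : ℕ}
    {P : (Fin (n + 1) → N) → Prop} (h : A.Definable L {p | P p}) (i : α) :
    A.Definable L {w : α ⊕ Fin n → N | P (Fin.cons (w (.inl i)) fun j => w (.inr j))} := by
  convert h.preimage_comp (Fin.cons (α := fun _ => α ⊕ Fin n) (.inl i) Sum.inr) using 1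
  ext w
  simp only [mem_ofPred_eq, mem_preimage]
  refine iff_of_eq (congrArg P ?_)
  funext j
  refine Fin.cases ?_ (fun j => ?_) j <;> simp

section

variable (hN : N ⊨ PA) (hX : IsNeutral X)

include hN hX

/-- The least element of `P` is definable over `a` in the expansion, so neutrality puts it into `dcl
LPA a`. The least number principle holds for sets definable in the model itself; to find a least
element it is enough that the part of `P` up to a known element `b` is such a set. -/
theorem exists_mem_dcl {a b : N} {P : N → Prop} (hb : P b)
    (hP : IsDefinable {x | P x ∧ (lt x b ∨ x = b)})
    (hE : DefinableIn X {a} {v : Fin 1 → N | P (v 0)}) : ∃ c, P c ∧ c ∈ dcl LPA a := by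
  obtain ⟨c, ⟨hc, hcb⟩, hmin⟩ := exists_least hN hP ⟨hb, Or.inr rfl⟩
  have hmin' : ∀ x, lt x c → ¬ P x := fun x hx hPx => hmin x hx ⟨hPx, Or.inl <| by
    rcases hcb with h | rfl
    · exact lt_trans' hN hx h
    · exact hx⟩
  refine ⟨c, hc, ?_⟩
  rw [hX a]
  let := unaryStructure X
  change ({a} : Set N).Definable (LPA.sum LUnary) {v : Fin 1 → N | v 0 ∈ ({c} : Set N)}
  have hlt : ∀ i j : Option (Fin 1), ({a} : Set N).Definable (LPA.sum LUnary)
      {v : Option (Fin 1) → N | lt (v i) (v j)} :=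
    fun i j => DefinableIn.of_definable (definable_lt i j)
  have : ({a} : Set N).Definable (LPA.sum LUnary)
      {v : Fin 1 → N | P (v 0) ∧ ∀ y, lt y (v 0) → ¬ P y} :=
    definable_and hE <| definable_all <| definable_imp (hlt _ _) <|
      definable_not <| definable_mem (S := {x | P x}) hE none
  convert this using 1
  ext v
  simp only [mem_singleton_iff, mem_ofPred_eq]
  refine ⟨fun h => h ▸ ⟨hc, hmin'⟩, fun ⟨h, h'⟩ => ?_⟩
  rcases lt_trichotomy' hN (v 0) c with h1 | h1 | h1
  · exact absurd h (hmin' _ h1)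
  · exact h1
  · exact absurd hc (h' _ h1)

/-- The coordinates are chosen one at a time: first a value that extends to a solution, then a
solution of the condition with this value inserted. -/
theorem exists_tuple_mem_dcl {a : N} : ∀ {n : ℕ} {P : (Fin n → N) → Prop} (_ : ∃ p, P p)
    (_ : (univ : Set N).Definable LPA {p | P p}) (_ : DefinableIn X {a} {p | P p}),
    ∃ p, P p ∧ ∀ i, p i ∈ dcl LPA a := by
  let := unaryStructure X
  intro n
  induction n with
  | zero => exact fun ⟨p, hp⟩ _ _ => ⟨p, hp, fun i => i.elim0⟩
  | succ n ih =>
    rintro P ⟨p, hp⟩ hP hE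
    obtain ⟨c, ⟨r, hr⟩, hca⟩ := exists_mem_dcl hN hX (a := a) (b := p 0)
      (P := fun x => ∃ r : Fin n → N, P (Fin.cons x r))
      ⟨Fin.tail p, by rwa [Fin.cons_self_tail]⟩
      (definable_and (definable_ex_tuple (definable_cons_tuple hP 0))
        (definable_const (P := fun v b => lt (v 0) b ∨ v 0 = b) _
          ((definable_lt _ _).union (definable_eq _ _))))
      (definable_ex_tuple (definable_cons_tuple (L := LPA.sum LUnary) hE 0))
    -- Used twice: in `LPA`, where `c` is a parameter, and in the expansion, where `c` is definable
    -- over `a`.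
    have key : ∀ {B : Set N} {L : FirstOrder.Language.{0, 0}} [L.Structure N],
        B.Definable₁ L {c} → B.Definable L {p | P p} →
        B.Definable L {r | P (Fin.cons c r)} := fun hc h => by
      refine definable_subst (P := fun r c => P (Fin.cons c r)) hc ?_
      exact (definable_cons_tuple h ()).preimage_comp
        (Sum.elim (fun _ => none) some : Unit ⊕ Fin n → Option (Fin n))
    obtain ⟨r, hr, hra⟩ := ih ⟨r, hr⟩ (key (Definable.singleton_of_mem LPA (mem_univ c)) hP)
      (key (L := LPA.sum LUnary) (DefinableIn.of_definable hca) hE)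
    exact ⟨_, hr, Fin.cases hca hra⟩

/-- If finitely many parameters suffice to define a set that is definable in the expansion over
`a`, then `a` suffices. -/
theorem definable_singleton_of_definableIn {a : N} {S : Set N} (hS : IsDefinable S)
    (hE : DefinableIn X {a} {v : Fin 1 → N | v 0 ∈ S}) : ({a} : Set N).Definable₁ LPA S := by
  let := unaryStructure X
  obtain ⟨n, p, φ, -, hφ⟩ := exists_formula_fin_params hS
  have hφ' : ∀ x, x ∈ S ↔ φ.Realize (Sum.elim p fun _ => x) := fun x =>
    Set.ext_iff.1 hφ (fun _ => x)
  have hdef : ∀ B : Set N, B.Definable LPA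
      {w : Option (Fin n) → N | φ.Realize (Sum.elim (fun i => w (some i)) fun _ => w none)} :=
    fun B => by
    convert (empty_definable_iff.2 ⟨φ, rfl⟩ : (∅ : Set N).Definable LPA _).mono
      (empty_subset B) |>.preimage_comp (Sum.elim some fun _ => none) using 1
    ext w
    simp only [mem_ofPred_eq, mem_preimage]
    refine iff_of_eq (congrArg _ ?_)
    funext i
    rcases i with i | i <;> rfl
  -- Being a tuple with which `φ` defines `S` is a definable condition, also over `a` in the
  -- expansion.
  obtain ⟨q, hq, hqa⟩ := exists_tuple_mem_dcl hN hX (a := a)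
    (P := fun q : Fin n → N => ∀ x, x ∈ S ↔ φ.Realize (Sum.elim q fun _ => x)) ⟨p, hφ'⟩
    (definable_all (definable_iff (definable_mem hS none) (hdef _)))
    (definable_all (L := LPA.sum LUnary) (definable_iff (definable_mem (S := S) hE none)
      (DefinableIn.of_definable (hdef _))))
  have := definable_subst_tuple (α := Fin 1)
    (P := fun v (q : Fin n → N) => φ.Realize (Sum.elim q fun _ => v 0)) hqa
    ((hdef {a}).preimage_comp (fun o : Option (Fin n) => o.elim (Sum.inl (0 : Fin 1)) Sum.inr))
  exact definable_congr this fun v => (hq _).symm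

omit hN hX in
-- Neutrality speaks of closures of single elements; 0 is itself definable, so it plays the part of
-- the empty parameter set.
theorem definable_empty_of_definable_zero {S : Set N}
    (h : ({zeroElem N} : Set N).Definable₁ LPA S) : IsZeroDefinable S := by
  obtain ⟨φ, hφ⟩ := exists_formula_of_definable_singleton h
  have : (∅ : Set N).Definable LPA
      {v : Fin 1 → N | φ.Realize (fun _ => zeroElem N) (fun _ => v 0)} := by
    refine definable_subst (P := fun v z => φ.Realize (fun _ => z) (fun _ => v 0)) ?_
      (definable_realize φ (fun _ => none) (fun _ => some 0))
    exact definable_eq_zero 0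
  exact definable_congr this fun v => hφ _

theorem isZeroDefinable_of_isDefinable (h : IsDefinable X) : IsZeroDefinable X :=
  definable_empty_of_definable_zero
    (definable_singleton_of_definableIn hN hX h (definableIn_mem 0))

theorem IsClass.definable_singleton (hC : IsClass X) (a : N) :
    ({a} : Set N).Definable₁ LPA {x | x ∈ X ∧ lt x a} := by
  let := unaryStructure X
  refine definable_singleton_of_definableIn hN hX (hC a) ?_
  exact definable_and (L := LPA.sum LUnary) (definableIn_mem 0)
    (DefinableIn.of_definable (definable_subst (P := fun v a => lt (v 0) a)
      (Definable.singleton_of_mem LPA (mem_singleton a)) (definable_lt _ _)))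

end

end Neutral

/-! ### Sets definable without parameters are neutral classes -/

section ZeroDefinable

variable {N : Type*} [LPA.Structure N] {X : Set N}

theorem exists_term_of_expansion {β : Type*} (t : (LPA.sum LUnary).Term β) :
    letI := unaryStructure X
    ∃ t' : LPA.Term β, ∀ v : β → N, t'.realize v = t.realize v := by
  let := unaryStructure X
  induction t with
  | var i => exact ⟨Term.var i, fun v => rfl⟩
  | func f ts ih =>
    choose ts' hts using ih
    rcases f with f | f
    · exact ⟨Term.func f ts', fun v => congrArg (Structure.funMap (L := LPA) f)
        (funext fun i => hts i v)⟩
    · exact f.elim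

/-- A `0`-definable predicate can be eliminated from formulas. -/
theorem exists_formula_of_expansion (hX : IsZeroDefinable X) {β : Type*} {n : ℕ}
    (φ : (LPA.sum LUnary).BoundedFormula β n) :
    letI := unaryStructure X
    ∃ ψ : LPA.BoundedFormula β n, ∀ (v : β → N) (xs : Fin n → N),
      ψ.Realize v xs ↔ φ.Realize v xs := by
  let := unaryStructure X
  induction φ with
  | falsum => exact ⟨⊥, fun v xs => Iff.rfl⟩
  | equal s t =>
    obtain ⟨s', hs⟩ := exists_term_of_expansion (X := X) s
    obtain ⟨t', ht⟩ := exists_term_of_expansion (X := X) t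
    exact ⟨s'.bdEqual t', fun v xs => by
      simp only [BoundedFormula.realize_bdEqual, hs, ht]
      rfl⟩
  | rel R ts =>
    choose ts' hts using fun i => exists_term_of_expansion (X := X) (ts i)
    rcases R with R | R
    · refine ⟨Relations.boundedFormula R ts', fun v xs => iff_of_eq ?_⟩
      exact congrArg (Structure.RelMap (L := LPA) R) (funext fun i => hts i _)
    · change UnaryRel _ at R
      cases R
      -- The predicate is replaced by its definition `χ`, applied to the term.
      obtain ⟨χ, hχ⟩ := empty_definable_iff.1 hX
      refine ⟨BoundedFormula.relabel (k := 0) id (BoundedFormula.subst χ fun _ => ts' 0),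
        fun v xs => ?_⟩
      rw [BoundedFormula.realize_relabel, BoundedFormula.realize_subst]
      have := Set.ext_iff.1 hχ (fun _ => (ts' 0).realize (Sum.elim v xs))
      simp only [mem_ofPred_eq] at this
      rw [hts] at this
      refine Iff.trans ?_ (this.symm.trans ?_)
      · rw [Formula.Realize, ← hts]
        exact iff_of_eq (congrArg₂ _ rfl (Subsingleton.elim _ _))
      · exact Iff.rfl
  | imp φ₁ φ₂ ih₁ ih₂ =>
    obtain ⟨ψ₁, h₁⟩ := ih₁
    obtain ⟨ψ₂, h₂⟩ := ih₂
    exact ⟨ψ₁.imp ψ₂, fun v xs => by simp only [BoundedFormula.realize_imp, h₁, h₂]⟩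
  | all φ ih =>
    obtain ⟨ψ, h⟩ := ih
    exact ⟨ψ.all, fun v xs => by simp only [BoundedFormula.realize_all, h]⟩

theorem IsZeroDefinable.isNeutral (hX : IsZeroDefinable X) : IsNeutral X := by
  intro a
  let := unaryStructure X
  refine Subset.antisymm (fun b hb => DefinableIn.of_definable (X := X) hb) fun b hb => ?_
  obtain ⟨φ, hφ⟩ := definable_iff_exists_formula_sum.1
    (show ({a} : Set N).Definable (LPA.sum LUnary) {v : Fin 1 → N | v 0 ∈ ({b} : Set N)} from hb)
  obtain ⟨ψ, hψ⟩ := exists_formula_of_expansion hX φ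
  refine definable_iff_exists_formula_sum.2 ⟨ψ, ?_⟩
  rw [hφ]
  ext v
  exact (hψ _ _).symm

theorem IsZeroDefinable.isNeutralClass (hX : IsZeroDefinable X) : IsNeutralClass X := by
  refine ⟨fun a => ?_, hX.isNeutral⟩
  exact definable_and (definable_mem (hX.mono (empty_subset _)) 0)
    (definable_const (P := fun v a => lt (v 0) a) _ (definable_lt _ _))

end ZeroDefinable

/-! ### Branches of trees of finite width -/

section FiniteWidth

/-- `P` and `Q` have the same elements below `a`. -/
def AgreeBelow {N : Type*} (r : N → N → Prop) (P Q : Set N) (a : N) : Prop :=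
  ∀ x, r x a → (x ∈ P ↔ x ∈ Q)

/-- All initial parts of `S j b` occur among the sets `S i a`. -/
def Coherent {N J : Type*} (r : N → N → Prop) (S : J → N → Set N) (j : J) (b : N) : Prop :=
  ∀ a, ¬ r b a → ∃ i, AgreeBelow r (S j b) (S i a) a

variable {N J : Type*}

/-- A branch of a tree of finite width is isolated, so that it can be described by an initial
part of it. -/
theorem exists_branch_description [LinearOrder N] [NoMaxOrder N] [Nonempty N] [Finite J]
    {X : Set N} {S : J → N → Set N} (h : ∀ a, ∃ j, AgreeBelow (· < ·) X (S j a) a) :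
    ∃ a, ∀ x, x ∈ X ↔ ∃ b₀, ∀ b, b₀ < b → ∀ j, Coherent (· < ·) S j b →
      AgreeBelow (· < ·) X (S j b) a → x ∈ S j b := by
  by_cases hiso : ∃ a, ∀ c, ∃ b₀, ∀ b, b₀ < b → ∀ j, Coherent (· < ·) S j b →
      AgreeBelow (· < ·) X (S j b) a → AgreeBelow (· < ·) X (S j b) c
  · obtain ⟨a, ha⟩ := hiso
    refine ⟨a, fun x => ⟨fun hx => ?_, ?_⟩⟩
    · obtain ⟨c, hc⟩ := exists_gt x
      obtain ⟨b₀, hb₀⟩ := ha c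
      exact ⟨b₀, fun b hb j hj hja => (hb₀ b hb j hj hja x hc).1 hx⟩
    · rintro ⟨b₀, hb₀⟩
      -- Beyond `x` and `a`, an approximation that is correct below `b` decides `x` correctly and
      -- agrees with `X` below `a`. It is coherent because all initial parts of `X` occur in the
      -- tree.
      obtain ⟨b, hb⟩ := exists_gt (max b₀ (max x a))
      simp only [max_lt_iff] at hb
      obtain ⟨j, hj⟩ := h b
      refine (hj x hb.2.1).2 (hb₀ b hb.1 j (fun d hd => ?_) fun y hy => hj y (hy.trans hb.2.2))
      obtain ⟨i, hi⟩ := h d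
      exact ⟨i, fun y hy => (hj y (hy.trans_le (not_lt.1 hd))).symm.trans (hi y hy)⟩
  · exfalso
    push Not at hiso
    -- If no `a` isolates `X`, then arbitrarily long nodes leave `X` between `a` and `c a`.
    -- Iterating `c` gives more splitting points than the tree has nodes at one level.
    choose c hc using hiso
    have hlt : ∀ a, a < c a := fun a => by
      obtain ⟨b, -, j, -, h1, h2⟩ := hc a a
      by_contra hle
      exact h2 fun x hx => h1 x (hx.trans_le (not_lt.1 hle))
    let a : ℕ → N := fun n => c^[n] (Classical.arbitrary N)
    have ha : ∀ n, a (n + 1) = c (a n) := fun n => Function.iterate_succ_apply' _ _ _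
    have hmono : Monotone a := monotone_nat_of_le_succ fun n => by
      rw [ha]; exact (hlt _).le
    -- One more than the number of indices available at level `a K`.
    let K := Nat.card J + 1
    have key : ∀ n : Fin K, ∃ i, AgreeBelow (· < ·) X (S i (a K)) (a n) ∧
        ¬ AgreeBelow (· < ·) X (S i (a K)) (a (n + 1)) := fun n => by
      obtain ⟨b, hb, j, hj, h1, h2⟩ := hc (a n) (a K)
      -- Coherence cuts the long node down to the common level `a K`.
      obtain ⟨i, hi⟩ := hj (a K) hb.not_gt
      refine ⟨i, fun x hx => (h1 x hx).trans (hi x (hx.trans_le (hmono n.2.le))),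
        fun h3 => h2 fun x hx => ?_⟩
      rw [← ha] at hx
      exact (h3 x hx).trans (hi x (hx.trans_le (hmono n.2))).symm
    choose i hi using key
    -- The node for `m` still agrees with `X` below `a (n + 1)`, where the node for `n` does not.
    have hne : ∀ n m : Fin K, n < m → i n ≠ i m := fun n m hnm heq =>
      (hi n).2 fun x hx => heq ▸ (hi m).1 x (hx.trans_le (hmono hnm))
    have hinj : Function.Injective i := fun n m hnm => by
      rcases lt_trichotomy n m with h' | h' | h'
      · exact absurd hnm (hne _ _ h')
      · exact h'
      · exact absurd hnm.symm (hne _ _ h')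
    have := Nat.card_le_card_of_injective i hinj
    simp [K] at this

variable [LPA.Structure N]

/-- The order of a model of `PA`. -/
noncomputable abbrev linearOrder (hN : N ⊨ PA) : LinearOrder N :=
  haveI : IsStrictTotalOrder N lt :=
    { irrefl := lt_irrefl' hN
      trans := fun _ _ _ => lt_trans' hN
      trichotomous := fun a b h h' => by
        rcases lt_trichotomy' hN a b with h1 | h1 | h1
        · exact absurd h1 h
        · exact h1
        · exact absurd h1 h' }
  haveI := Classical.decRel (lt (M := N))
  linearOrderOfSTO lt

/-- The description of the branch mentions `X` only below a fixed `a`, where a class is definable.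
-/
theorem IsClass.isDefinable_of_finite_width (hN : N ⊨ PA) [Finite J] {X : Set N} (hX : IsClass X)
    {S : J → N → Set N}
    (hS : ∀ j, (univ : Set N).Definable LPA {v : Fin 2 → N | v 1 ∈ S j (v 0)})
    (h : ∀ a, ∃ j, AgreeBelow lt X (S j a) a) : IsDefinable X := by
  let := linearOrder hN
  have : NoMaxOrder N := ⟨fun a => ⟨_, lt_succ_self hN a⟩⟩
  have : Nonempty N := ⟨zeroElem N⟩
  obtain ⟨a, ha⟩ := exists_branch_description (N := N) h
  have hS' : ∀ {α : Type} (j : J) (x b : α),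
      (univ : Set N).Definable LPA {v : α → N | v x ∈ S j (v b)} :=
    fun j x b => (hS j).preimage_comp ![b, x]
  have hcoh : ∀ {α : Type} [Finite α] (j : J) (b : α),
      (univ : Set N).Definable LPA {v : α → N | Coherent lt S j (v b)} := fun j b => by
    refine definable_all <| definable_imp (definable_not (definable_lt _ _)) <|
      definable_finite_ex fun i => definable_all <| definable_imp (definable_lt _ _) <|
      definable_iff (hS' _ _ _) (hS' _ _ _)
  have hagree : ∀ {α : Type} [Finite α] (j : J) (b : α),
      (univ : Set N).Definable LPA {v : α → N | AgreeBelow lt X (S j (v b)) a} := fun {α} _ j b => by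
    have : (univ : Set N).Definable LPA {v : α → N | ∀ x,
        x ∈ {x | x ∈ X ∧ lt x a} ↔ (lt x a ∧ x ∈ S j (v b))} := by
      refine definable_all (definable_iff (definable_mem (hX a) none) (definable_and ?_
        (hS' _ _ _)))
      exact definable_const (P := fun v a => lt (v none) a) _ (definable_lt _ _)
    refine definable_congr this fun v => forall_congr' fun x => ?_
    rw [mem_ofPred_eq]
    tauto
  have : (univ : Set N).Definable LPA {v : Fin 1 → N | ∃ b₀, ∀ b, lt b₀ b → ∀ j,
      Coherent lt S j b → AgreeBelow lt X (S j b) a → v 0 ∈ S j b} :=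
    definable_ex <| definable_all <| definable_imp (definable_lt _ _) <| definable_finite_all
      fun j => definable_imp (hcoh _ _) <| definable_imp (hagree _ _) (hS' _ _ _)
  exact definable_congr this fun v => (ha _).symm

end FiniteWidth

/-! ### Recursiveness of sets of Gödel numbers -/

section Codes

/-- The maximum of `a` and `b`, or `0` if one of them is `0`. -/
def joinLevel (a b : ℕ) : ℕ := if a = 0 then 0 else if b = 0 then 0 else max a b

theorem joinLevel_spec {a b n : ℕ} :
    (0 < joinLevel a b ∧ joinLevel a b ≤ n) ↔ (0 < a ∧ a ≤ n) ∧ (0 < b ∧ b ≤ n) := by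
  unfold joinLevel
  split_ifs <;> omega

/-- The recursion step for `termLevel`. -/
def termLevelStep (m k : ℕ) (g : ℕ → ℕ) : ℕ :=
  if k.unpair.1 = 0 then (if k.unpair.2 < m then 1 else 0)
  -- The bound variable `r` needs `n = r + 1`, and levels are shifted by one.
  else if k.unpair.1 = 1 then k.unpair.2 + 2
  else if k.unpair.1 < 4 then (if k.unpair.2 = 0 then 1 else 0)
  else if k.unpair.1 < 6 then joinLevel (g k.unpair.2.unpair.1) (g k.unpair.2.unpair.2)
  else 0

/-- If `k` codes a term with free variables in `Fin m`, then `termLevel m k = n + 1` for the least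
`n` such that the bound variables are in `Fin n`; otherwise `termLevel m k = 0`. -/
def termLevel (m k : ℕ) : ℕ :=
  termLevelStep m k fun i => if _ : i < k then termLevel m i else 0

/-- The recursion step for `formulaLevel`. -/
def formulaLevelStep (m k : ℕ) (g : ℕ → ℕ) : ℕ :=
  if k.unpair.1 = 0 then (if k.unpair.2 = 0 then 1 else 0)
  else if k.unpair.1 < 3 then
    joinLevel (termLevel m k.unpair.2.unpair.1) (termLevel m k.unpair.2.unpair.2)
  else if k.unpair.1 = 3 then joinLevel (g k.unpair.2.unpair.1) (g k.unpair.2.unpair.2)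
  -- A quantifier binds one variable; the maximum prevents a closed body from getting the level 0 of
  -- a non-formula.
  else if k.unpair.1 = 4 then (if g k.unpair.2 = 0 then 0 else max 1 (g k.unpair.2 - 1))
  else 0

/-- If `k` codes a formula with free variables in `Fin m`, then `formulaLevel m k = n + 1` for the
least `n` such that it codes a `BoundedFormula (Fin m) n`; otherwise `formulaLevel m k = 0`. -/
def formulaLevel (m k : ℕ) : ℕ :=
  formulaLevelStep m k fun i => if _ : i < k then formulaLevel m i else 0

/-- Course-of-values recursion: the list holds the values below `k`, and the default 0 of `getD`
matches the value prescribed outside this range. -/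
theorem strong_recursion_primrec {f : ℕ → ℕ} {s : ℕ → (ℕ → ℕ) → ℕ}
    (hs : Primrec fun l : List ℕ => s l.length fun i => l.getD i 0)
    (hf : ∀ k, f k = s k fun i => if i < k then f i else 0) : Primrec f := by
  have : Primrec₂ fun (_ : Unit) k => f k := by
    refine Primrec.nat_strong_rec (fun (_ : Unit) k => f k)
      (g := fun _ l => some (s l.length fun i => l.getD i 0))
      (Primrec.option_some.comp (hs.comp Primrec.snd)).to₂ fun _ n => ?_
    simp only [List.length_map, List.length_range, Option.some.injEq]
    rw [hf n]
    congr 1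
    funext i
    by_cases h : i < n <;> simp [List.getD, h]
  exact this.comp (Primrec.const ()) Primrec.id

theorem joinLevel_primrec : Primrec₂ joinLevel := by
  refine Primrec.ite (Primrec.eq.comp Primrec.fst (Primrec.const 0)) (Primrec.const 0) ?_
  refine Primrec.ite (Primrec.eq.comp Primrec.snd (Primrec.const 0)) (Primrec.const 0) ?_
  exact Primrec.nat_max.comp Primrec.fst Primrec.snd

theorem unpair_fst_primrec : Primrec fun k : ℕ => k.unpair.1 := Primrec.fst.comp Primrec.unpair

theorem unpair_snd_primrec : Primrec fun k : ℕ => k.unpair.2 := Primrec.snd.comp Primrec.unpair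

theorem termLevel_primrec (m : ℕ) : Primrec (termLevel m) := by
  refine strong_recursion_primrec (s := termLevelStep m) ?_ fun k => by
    rw [termLevel]; simp only [dite_eq_ite]
  have hk : Primrec fun l : List ℕ => l.length := Primrec.list_length
  have h1 := unpair_fst_primrec.comp hk
  have h2 := unpair_snd_primrec.comp hk
  have hg : ∀ {q : List ℕ → ℕ}, Primrec q → Primrec fun l : List ℕ => l.getD (q l) 0 :=
    fun hq => (Primrec.list_getD 0).comp Primrec.id hq
  have c : ∀ n : ℕ, Primrec fun _ : List ℕ => n := Primrec.const
  unfold termLevelStep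
  refine Primrec.ite (Primrec.eq.comp h1 (c 0))
    (Primrec.ite (Primrec.nat_lt.comp h2 (c m)) (c 1) (c 0)) ?_
  refine Primrec.ite (Primrec.eq.comp h1 (c 1)) (Primrec.nat_add.comp h2 (c 2)) ?_
  refine Primrec.ite (Primrec.nat_lt.comp h1 (c 4))
    (Primrec.ite (Primrec.eq.comp h2 (c 0)) (c 1) (c 0)) ?_
  exact Primrec.ite (Primrec.nat_lt.comp h1 (c 6)) (joinLevel_primrec.comp
    (hg (unpair_fst_primrec.comp h2)) (hg (unpair_snd_primrec.comp h2))) (c 0)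

theorem formulaLevel_primrec (m : ℕ) : Primrec (formulaLevel m) := by
  refine strong_recursion_primrec (s := formulaLevelStep m) ?_ fun k => by
    rw [formulaLevel]; simp only [dite_eq_ite]
  have hk : Primrec fun l : List ℕ => l.length := Primrec.list_length
  have h1 := unpair_fst_primrec.comp hk
  have h2 := unpair_snd_primrec.comp hk
  have hg : ∀ {q : List ℕ → ℕ}, Primrec q → Primrec fun l : List ℕ => l.getD (q l) 0 :=
    fun hq => (Primrec.list_getD 0).comp Primrec.id hq
  have c : ∀ n : ℕ, Primrec fun _ : List ℕ => n := Primrec.const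
  unfold formulaLevelStep
  refine Primrec.ite (Primrec.eq.comp h1 (c 0))
    (Primrec.ite (Primrec.eq.comp h2 (c 0)) (c 1) (c 0)) ?_
  refine Primrec.ite (Primrec.nat_lt.comp h1 (c 3)) (joinLevel_primrec.comp
    ((termLevel_primrec m).comp (unpair_fst_primrec.comp h2))
    ((termLevel_primrec m).comp (unpair_snd_primrec.comp h2))) ?_
  refine Primrec.ite (Primrec.eq.comp h1 (c 3)) (joinLevel_primrec.comp
    (hg (unpair_fst_primrec.comp h2)) (hg (unpair_snd_primrec.comp h2))) ?_
  exact Primrec.ite (Primrec.eq.comp h1 (c 4)) (Primrec.ite (Primrec.eq.comp (hg h2) (c 0)) (c 0)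
    (Primrec.nat_max.comp (c 1) (Primrec.nat_sub.comp (hg h2) (c 1)))) (c 0)

theorem snd_lt_pair {t r : ℕ} (ht : 0 < t) : r < Nat.pair t r :=
  lt_of_lt_of_le (by omega) (Nat.add_le_pair t r)

theorem fst_lt_pair_pair {t a b : ℕ} (ht : 0 < t) : a < Nat.pair t (Nat.pair a b) :=
  (Nat.left_le_pair a b).trans_lt (snd_lt_pair ht)

theorem snd_lt_pair_pair {t a b : ℕ} (ht : 0 < t) : b < Nat.pair t (Nat.pair a b) :=
  (Nat.right_le_pair a b).trans_lt (snd_lt_pair ht)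

theorem termLevel_codeTerm {m n : ℕ} (t : LPA.Term (Fin m ⊕ Fin n)) :
    0 < termLevel m (codeTerm t) ∧ termLevel m (codeTerm t) ≤ n + 1 := by
  induction t with
  | var i =>
    rcases i with i | i
    · rw [codeTerm, termLevel]
      simp [termLevelStep]
    · rw [codeTerm, termLevel]
      simp [termLevelStep]
  | func f ts ih =>
    cases f with
    | zero => rw [codeTerm, termLevel]; simp [termLevelStep]
    | one => rw [codeTerm, termLevel]; simp [termLevelStep]
    | add =>
      rw [codeTerm, termLevel]
      simp only [termLevelStep, Nat.unpair_pair]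
      rw [dif_pos (fst_lt_pair_pair (by omega)), dif_pos (snd_lt_pair_pair (by omega))]
      simpa using joinLevel_spec.2 ⟨ih 0, ih 1⟩
    | mul =>
      rw [codeTerm, termLevel]
      simp only [termLevelStep, Nat.unpair_pair]
      rw [dif_pos (fst_lt_pair_pair (by omega)), dif_pos (snd_lt_pair_pair (by omega))]
      simpa using joinLevel_spec.2 ⟨ih 0, ih 1⟩

theorem exists_codeTerm {m n : ℕ} (k : ℕ) (h : 0 < termLevel m k ∧ termLevel m k ≤ n + 1) :
    ∃ t : LPA.Term (Fin m ⊕ Fin n), codeTerm t = k := by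
  induction k using Nat.strong_induction_on with
  | _ k ih =>
    obtain ⟨t, r, rfl⟩ : ∃ t r, k = Nat.pair t r := ⟨_, _, (Nat.pair_unpair k).symm⟩
    obtain ⟨a, b, rfl⟩ : ∃ a b, r = Nat.pair a b := ⟨_, _, (Nat.pair_unpair r).symm⟩
    rw [termLevel] at h
    simp only [termLevelStep, Nat.unpair_pair] at h
    by_cases h0 : t = 0
    · subst h0
      by_cases hr : Nat.pair a b < m
      · exact ⟨.var (.inl ⟨_, hr⟩), rfl⟩
      · simp [hr] at h
    by_cases h1 : t = 1
    · subst h1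
      simp only [one_ne_zero, if_true, if_false] at h
      exact ⟨.var (.inr ⟨Nat.pair a b, by omega⟩), rfl⟩
    by_cases h3 : t < 4
    · simp only [h0, h1, h3, if_true, if_false] at h
      by_cases hr : Nat.pair a b = 0
      · rw [hr]
        obtain rfl | rfl : t = 2 ∨ t = 3 := by omega
        · exact ⟨.func PAFunc.zero ![], rfl⟩
        · exact ⟨.func PAFunc.one ![], rfl⟩
      · simp [hr] at h
    by_cases h6 : t < 6
    · simp only [h0, h1, h3, h6, if_true, if_false] at h
      have ha : a < Nat.pair t (Nat.pair a b) := fst_lt_pair_pair (by omega)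
      have hb : b < Nat.pair t (Nat.pair a b) := snd_lt_pair_pair (by omega)
      rw [dif_pos ha, dif_pos hb, joinLevel_spec] at h
      obtain ⟨s, hs⟩ := ih a ha h.1
      obtain ⟨u, hu⟩ := ih b hb h.2
      obtain rfl | rfl : t = 4 ∨ t = 5 := by omega
      · exact ⟨.func PAFunc.add ![s, u], by simp [codeTerm, hs, hu]⟩
      · exact ⟨.func PAFunc.mul ![s, u], by simp [codeTerm, hs, hu]⟩
    · simp [h0, h1, h3, h6] at h

theorem formulaLevel_codeFormula {m n : ℕ} (φ : LPA.BoundedFormula (Fin m) n) :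
    0 < formulaLevel m (codeFormula φ) ∧ formulaLevel m (codeFormula φ) ≤ n + 1 := by
  induction φ with
  | falsum => rw [codeFormula, formulaLevel]; simp [formulaLevelStep]
  | equal s t =>
    rw [codeFormula, formulaLevel]
    simpa [formulaLevelStep] using joinLevel_spec.2 ⟨termLevel_codeTerm s, termLevel_codeTerm t⟩
  | rel R ts =>
    cases R
    rw [codeFormula, formulaLevel]
    simpa [formulaLevelStep] using
      joinLevel_spec.2 ⟨termLevel_codeTerm (ts 0), termLevel_codeTerm (ts 1)⟩
  | imp φ ψ ih₁ ih₂ =>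
    rw [codeFormula, formulaLevel]
    simp only [formulaLevelStep, Nat.unpair_pair]
    rw [dif_pos (fst_lt_pair_pair (by omega)), dif_pos (snd_lt_pair_pair (by omega))]
    simpa using joinLevel_spec.2 ⟨ih₁, ih₂⟩
  | all φ ih =>
    rw [codeFormula, formulaLevel]
    simp only [formulaLevelStep, Nat.unpair_pair]
    rw [dif_pos (snd_lt_pair (by omega))]
    split_ifs <;> first | omega | contradiction

theorem exists_codeFormula {m : ℕ} (k : ℕ) : ∀ {n : ℕ},
    0 < formulaLevel m k ∧ formulaLevel m k ≤ n + 1 →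
    ∃ φ : LPA.BoundedFormula (Fin m) n, codeFormula φ = k := by
  induction k using Nat.strong_induction_on with
  | _ k ih =>
    intro n h
    obtain ⟨t, r, rfl⟩ : ∃ t r, k = Nat.pair t r := ⟨_, _, (Nat.pair_unpair k).symm⟩
    obtain ⟨a, b, rfl⟩ : ∃ a b, r = Nat.pair a b := ⟨_, _, (Nat.pair_unpair r).symm⟩
    rw [formulaLevel] at h
    simp only [formulaLevelStep, Nat.unpair_pair] at h
    by_cases h0 : t = 0
    · subst h0
      by_cases hr : Nat.pair a b = 0
      · exact ⟨.falsum, by rw [hr]; rfl⟩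
      · simp [hr] at h
    by_cases h3 : t < 3
    · simp only [h0, h3, if_true, if_false] at h
      rw [joinLevel_spec] at h
      obtain ⟨s, hs⟩ := exists_codeTerm a h.1
      obtain ⟨u, hu⟩ := exists_codeTerm b h.2
      obtain rfl | rfl : t = 1 ∨ t = 2 := by omega
      · exact ⟨.equal s u, by rw [codeFormula, hs, hu]⟩
      · exact ⟨.rel PARel.lt ![s, u], by simp [codeFormula, hs, hu]⟩
    by_cases h4 : t = 3
    · subst h4
      simp only [if_true, if_false, h0, h3] at h
      have ha : a < Nat.pair 3 (Nat.pair a b) := fst_lt_pair_pair (by omega)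
      have hb : b < Nat.pair 3 (Nat.pair a b) := snd_lt_pair_pair (by omega)
      rw [dif_pos ha, dif_pos hb, joinLevel_spec] at h
      obtain ⟨φ, hφ⟩ := ih a ha h.1
      obtain ⟨ψ, hψ⟩ := ih b hb h.2
      exact ⟨φ.imp ψ, by rw [codeFormula, hφ, hψ]⟩
    by_cases h5 : t = 4
    · subst h5
      simp only [if_true, if_false, h0, h3, h4] at h
      have hr : Nat.pair a b < Nat.pair 4 (Nat.pair a b) := snd_lt_pair (by omega)
      rw [dif_pos hr] at h
      obtain ⟨φ, hφ⟩ := ih _ hr (n := n + 1) (by split_ifs at h <;> omega)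
      exact ⟨φ.all, by rw [codeFormula, hφ]⟩
    · simp [h0, h3, h4, h5] at h

/-- The image of all formulas under an operation that acts on the Gödel numbers by a primitive
recursive function is recursive. -/
theorem isRecursive_range {m l n : ℕ} {F : LPA.BoundedFormula (Fin m) n → LPA.Formula (Fin l)}
    {f : ℕ → ℕ} (hf : Primrec f) (hle : ∀ k, k ≤ f k)
    (hF : ∀ φ, codeFormula (F φ) = f (codeFormula φ)) : IsRecursive (Set.range F) := by
  have h : PrimrecRel fun (j k : ℕ) => f j = k ∧ (0 < formulaLevel m j ∧
      formulaLevel m j ≤ n + 1) := by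
    have hl := (formulaLevel_primrec m).comp (Primrec.fst (α := ℕ) (β := ℕ))
    exact (Primrec.eq.comp (hf.comp Primrec.fst) Primrec.snd).and
      ((Primrec.nat_lt.comp (Primrec.const 0) hl).and (Primrec.nat_le.comp hl (Primrec.const _)))
  -- Since `k ≤ f k`, the search for a preimage of `k` is bounded by `k`.
  have h' := (h.exists_lt).comp Primrec.succ Primrec.id
  refine (PrimrecPred.of_eq h' fun k => ?_).computablePred
  constructor
  · rintro ⟨j, -, hj, hlev⟩
    obtain ⟨φ, rfl⟩ := exists_codeFormula j hlev
    exact ⟨F φ, ⟨φ, rfl⟩, (hF φ).trans hj⟩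
  · rintro ⟨_, ⟨φ, rfl⟩, hφ⟩
    refine ⟨codeFormula φ, ?_, (hF φ).symm.trans hφ, formulaLevel_codeFormula φ⟩
    exact Nat.lt_succ_of_le ((hle _).trans_eq ((hF φ).symm.trans hφ))

/-- A code records only the numerical index of a variable, so enlarging the set of variables does
not change it. -/
theorem codeTerm_relabel {m l n : ℕ} (g : Fin m → Fin l) (hg : ∀ i, (g i : ℕ) = i)
    (t : LPA.Term (Fin m ⊕ Fin n)) :
    codeTerm (t.subst (Sum.elim (Term.relabel Sum.inl ∘ fun i => Term.var (g i)) (Term.var ∘ Sum.inr)) :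
      LPA.Term (Fin l ⊕ Fin n)) = codeTerm t := by
  induction t with
  | var i => rcases i with i | i <;> simp [codeTerm, hg]
  | func f ts ih => cases f <;> simp [codeTerm, ih]

theorem codeFormula_subst {m l n : ℕ} (g : Fin m → Fin l) (hg : ∀ i, (g i : ℕ) = i)
    (φ : LPA.BoundedFormula (Fin m) n) :
    codeFormula (φ.subst (fun i => (Term.var (g i) : LPA.Term (Fin l)))) = codeFormula φ := by
  induction φ with
  | falsum => rfl
  | equal s t =>
    exact congrArg₂ (fun a b => Nat.pair 1 (Nat.pair a b)) (codeTerm_relabel g hg s)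
      (codeTerm_relabel g hg t)
  | rel R ts =>
    cases R
    exact congrArg₂ (fun a b => Nat.pair 2 (Nat.pair a b)) (codeTerm_relabel g hg (ts 0))
      (codeTerm_relabel g hg (ts 1))
  | imp φ ψ ih₁ ih₂ => exact congrArg₂ (fun a b => Nat.pair 3 (Nat.pair a b)) ih₁ ih₂
  | all φ ih => exact congrArg (Nat.pair 4) ih

end Codes

/-! ### Two applications of recursive saturation -/

section Saturation

/-- The Gödel number of an implication. -/
def impCode (a b : ℕ) : ℕ := Nat.pair 3 (Nat.pair a b)

/-- The Gödel number of a universal formula. -/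
def allCode (a : ℕ) : ℕ := Nat.pair 4 a

theorem le_impCode_left {k a b : ℕ} (h : k ≤ a) : k ≤ impCode a b :=
  h.trans (fst_lt_pair_pair (by omega)).le

theorem le_impCode_right {k a b : ℕ} (h : k ≤ b) : k ≤ impCode a b :=
  h.trans (snd_lt_pair_pair (by omega)).le

theorem le_allCode {k a : ℕ} (h : k ≤ a) : k ≤ allCode a :=
  h.trans (Nat.right_le_pair _ _)

theorem impCode_primrec {f g : ℕ → ℕ} (hf : Primrec f) (hg : Primrec g) :
    Primrec fun k => impCode (f k) (g k) :=
  Primrec₂.natPair.comp (Primrec.const 3) (Primrec₂.natPair.comp hf hg)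

theorem allCode_primrec {f : ℕ → ℕ} (hf : Primrec f) : Primrec fun k => allCode (f k) :=
  Primrec₂.natPair.comp (Primrec.const 4) hf

/-- The formula expressing that `ψ` has a solution below the free variable if it has one at all. -/
def boundingFormula (ψ : LPA.BoundedFormula (Fin 0) 1) : LPA.Formula (Fin 1) :=
  let ψ' : LPA.BoundedFormula (Fin 1) 1 := ψ.subst fun i => Term.var (Fin.castLE (by omega) i)
  (∀' (ltFormula &0 (Term.var (Sum.inl 0)) ⟹ ∼ψ')) ⟹ ∀' ∼ψ'

theorem isRecursive_boundingFormula : IsRecursive (Set.range boundingFormula) := by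
  -- Negation is implication of falsum, whose code is 0.
  refine isRecursive_range (f := fun k => impCode
    (allCode (impCode (codeFormula (m := 1) (n := 1) (ltFormula &0 (Term.var (Sum.inl 0))))
      (impCode k 0))) (allCode (impCode k 0))) ?_ ?_ fun ψ => ?_
  · have h0 : Primrec fun k => impCode k 0 := impCode_primrec Primrec.id (Primrec.const 0)
    exact impCode_primrec (allCode_primrec (impCode_primrec (Primrec.const _) h0))
      (allCode_primrec h0)
  · exact fun k => le_impCode_right (le_allCode (le_impCode_left le_rfl))
  · have h := codeFormula_subst (Fin.castLE (by omega : 0 ≤ 1)) (fun _ => rfl) ψ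
    rw [← h]
    rfl

theorem realize_boundingFormula {M : Type*} [LPA.Structure M] (ψ : LPA.BoundedFormula (Fin 0) 1)
    (v : Fin 1 → M) : (boundingFormula ψ).Realize v ↔
      ((∀ w : M, lt w (v 0) → ¬ ψ.Realize Fin.elim0 fun _ => w) →
        ∀ w : M, ¬ ψ.Realize Fin.elim0 fun _ => w) := by
  have h0 : ∀ f : Fin 0 → M, f = Fin.elim0 := fun f => Subsingleton.elim _ _
  have h1 : ∀ (f : Fin 0 → M) (w : M), (Fin.snoc f w : Fin 1 → M) = fun _ => w := fun f w => by
    funext i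
    simp [Fin.snoc]
  simp [boundingFormula, Formula.Realize, realize_lt, BoundedFormula.realize_subst, h0, h1]

/-- The formula expressing that the first free variable is smaller than the second one and that
below the former `φ` (with the former) and `χ` (with the latter) differ. -/
def differFormula (χ φ : LPA.BoundedFormula (Fin 1) 1) : LPA.Formula (Fin 2) :=
  let φ' : LPA.BoundedFormula (Fin 2) 1 := φ.subst fun i => Term.var (Fin.castLE (by omega) i)
  let χ' : LPA.BoundedFormula (Fin 2) 1 := χ.subst fun _ => Term.var 1
  ∼(ltFormula (Term.var (Sum.inl 0)) (Term.var (Sum.inl 1)) ⟹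
    ∀' (ltFormula &0 (Term.var (Sum.inl 0)) ⟹ φ'.iff χ'))

theorem isRecursive_differFormula (χ : LPA.BoundedFormula (Fin 1) 1) :
    IsRecursive (Set.range (differFormula χ)) := by
  let x : ℕ := codeFormula (χ.subst fun _ => (Term.var 1 : LPA.Term (Fin 2)))
  -- The equivalence is unfolded into implications and falsum; `χ` is fixed, so its code `x` is a
  -- constant.
  refine isRecursive_range (f := fun k => impCode (impCode
    (codeFormula (m := 2) (n := 0) (ltFormula (Term.var (Sum.inl 0)) (Term.var (Sum.inl 1))))
    (allCode (impCode (codeFormula (m := 2) (n := 1) (ltFormula &0 (Term.var (Sum.inl 0))))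
      (impCode (impCode (impCode k x) (impCode (impCode x k) 0)) 0)))) 0) ?_ ?_ fun φ => ?_
  · have hk : Primrec fun k : ℕ => k := Primrec.id
    have c : ∀ n : ℕ, Primrec fun _ : ℕ => n := Primrec.const
    exact impCode_primrec (impCode_primrec (c _) (allCode_primrec (impCode_primrec (c _)
      (impCode_primrec (impCode_primrec (impCode_primrec hk (c _))
        (impCode_primrec (impCode_primrec (c _) hk) (c _))) (c _))))) (c _)
  · exact fun k => le_impCode_left (le_impCode_right (le_allCode (le_impCode_right
      (le_impCode_left (le_impCode_left (le_impCode_left le_rfl))))))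
  · have h := codeFormula_subst (Fin.castLE (by omega : 1 ≤ 2)) (fun _ => rfl) φ
    rw [← h]
    rfl

theorem realize_differFormula {M : Type*} [LPA.Structure M] (χ φ : LPA.BoundedFormula (Fin 1) 1)
    (v : Fin 2 → M) : (differFormula χ φ).Realize v ↔
      (lt (v 0) (v 1) ∧ ¬ ∀ x, lt x (v 0) → (φ.Realize (fun _ => v 0) (fun _ => x) ↔
        χ.Realize (fun _ => v 1) fun _ => x)) := by
  have h0 : ∀ i : Fin 1, Fin.castLE (by omega : 1 ≤ 2) i = 0 := fun i => by
    rw [Subsingleton.elim i 0]; rfl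
  have h1 : ∀ (f : Fin 0 → M) (w : M), (Fin.snoc f w : Fin 1 → M) = fun _ => w := fun f w => by
    funext i
    simp [Fin.snoc]
  simp [differFormula, Formula.Realize, realize_lt, BoundedFormula.realize_subst, h0, h1]

variable {M N : Type*} [LPA.Structure M] [LPA.Structure N]

/-- Each bounding formula holds of all sufficiently large elements, so together they are finitely
satisfiable. A realization in `M` keeps its properties in `N` and so exceeds the unique solution of
any defining formula. -/
theorem exists_gt_definable (hN : N ⊨ PA) (e : M ↪ₑ[LPA] N) (hsat : RecursivelySaturated M) :
    ∃ u : M, ∀ c : N, (∅ : Set N).Definable₁ LPA {c} → lt c (e u) := by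
  have hM : M ⊨ PA := (e.theory_model_iff PA).2 hN
  let := linearOrder hM
  have : Nonempty M := ⟨zeroElem M⟩
  have hbound : ∀ φ ∈ Set.range boundingFormula, ∃ u₀ : M, ∀ u, u₀ < u →
      φ.Realize (fun _ => u) := by
    rintro _ ⟨ψ, rfl⟩
    by_cases h : ∃ w : M, ψ.Realize Fin.elim0 fun _ => w
    · obtain ⟨w, hw⟩ := h
      exact ⟨w, fun u hu => (realize_boundingFormula _ _).2 fun h' => absurd hw (h' w hu)⟩
    · push Not at h
      exact ⟨zeroElem M, fun u _ => (realize_boundingFormula _ _).2 fun _ => h⟩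
  have hcons : ∀ x : M, (Fin.cons x Fin.elim0 : Fin 1 → M) = fun _ => x := fun x => by
    funext i
    exact Fin.cases rfl (fun i => i.elim0) i
  obtain ⟨u, hu⟩ := hsat 0 Fin.elim0 (Set.range boundingFormula) isRecursive_boundingFormula
    fun s hs => by
      choose! b hb using hbound
      have : ∃ m : M, ∀ φ ∈ s, b φ ≤ m := by
        obtain ⟨m, hm⟩ := (s.image b).exists_le
        exact ⟨m, fun φ hφ => hm _ (Finset.mem_image_of_mem b hφ)⟩
      obtain ⟨m, hm⟩ := this
      refine ⟨succElem m, fun φ hφ => ?_⟩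
      rw [hcons]
      exact hb φ (hs hφ) _ ((hm φ hφ).trans_lt (lt_succ_self hM m))
  refine ⟨u, fun c hc => ?_⟩
  obtain ⟨ψ, hψ⟩ := exists_formula_of_definable_empty hc
  have h1 := hu _ ⟨ψ, rfl⟩
  rw [hcons, ← e.map_formula, realize_boundingFormula] at h1
  by_contra hcu
  refine h1 (fun w hw hψw => hcu ?_) c ((hψ c).2 rfl)
  rw [← show w = c from (hψ w).1 hψw]
  exact hw

theorem realize_ex_first {K : Type*} [LPA.Structure K] (θ : LPA.Formula (Fin 2)) (v : Fin 1 → K) :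
    (Formula.iExs (Fin 1) (θ.relabel ![Sum.inr 0, Sum.inl 0]) : LPA.Formula (Fin 1)).Realize v ↔
      ∃ x, θ.Realize ![x, v 0] := by
  have hcomp : ∀ y : Fin 1 → K,
      Sum.elim v y ∘ ![Sum.inr 0, Sum.inl 0] = ![y 0, v 0] := fun y => by
    funext i
    fin_cases i <;> rfl
  simp only [Formula.realize_iExs, Formula.realize_relabel]
  refine ⟨fun ⟨y, hy⟩ => ⟨y 0, ?_⟩, fun ⟨x, hx⟩ => ⟨fun _ => x, ?_⟩⟩
  · rw [← hcomp]; exact hy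
  · rw [← hcomp (fun _ => x)] at hx; exact hx

theorem exists_realize_of_elementaryEmbedding (e : M ↪ₑ[LPA] N) (θ : LPA.Formula (Fin 2)) (u : M)
    {a : N} (h : θ.Realize ![a, e u]) : ∃ b : M, θ.Realize ![b, u] :=
  (realize_ex_first θ fun _ => u).1 <|
    (e.map_formula _ _).1 <| (realize_ex_first θ (e ∘ fun _ => u)).2 ⟨a, h⟩

/-- If every initial part of `X` is definable over its length, then below a given element of a
recursively saturated elementary submodel finitely many formulas suffice for this. -/
theorem exists_finite_formulas (e : M ↪ₑ[LPA] N) (hsat : RecursivelySaturated M) (hN : N ⊨ PA)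
    {X : Set N} (hX : ∀ a : N, ({a} : Set N).Definable₁ LPA {x | x ∈ X ∧ lt x a}) (u : M) :
    ∃ s : Finset (LPA.BoundedFormula (Fin 1) 1), ∀ a : N, lt a (e u) →
      ∃ φ ∈ s, AgreeBelow lt X {x | φ.Realize (fun _ => a) fun _ => x} a := by
  -- The type may not mention `X`; below `u`, the formula `χ` with parameter `u` replaces it.
  obtain ⟨χ, hχ⟩ := exists_formula_of_definable_singleton (hX (e u))
  have hagree : ∀ (φ : LPA.BoundedFormula (Fin 1) 1) (a : N), lt a (e u) →
      (¬ (differFormula χ φ).Realize ![a, e u] ↔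
        AgreeBelow lt X {x | φ.Realize (fun _ => a) fun _ => x} a) := fun φ a ha => by
    rw [realize_differFormula]
    simp only [Matrix.cons_val_zero, Matrix.cons_val_one, ha, true_and, not_not]
    refine forall_congr' fun x => forall_congr' fun hx => ?_
    rw [hχ, mem_ofPred_eq, mem_ofPred_eq, and_iff_left (lt_trans' hN hx ha)]
    exact Iff.comm
  have hcons : ∀ x : M, (Fin.cons x (fun _ => u) : Fin 2 → M) = ![x, u] := fun x => by
    funext i
    refine Fin.cases rfl (fun i => ?_) i
    rw [Subsingleton.elim i 0]
    rfl
  have hcomp : ∀ x : M, ![e x, e u] = e ∘ ![x, u] := fun x => by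
    funext i
    fin_cases i <;> rfl
  by_contra! hcon
  -- A finite part of the type has a solution in `N`, and by elementarity one in `M`, because its
  -- only parameter is `u`.
  obtain ⟨a, ha⟩ := hsat 1 (fun _ => u) _ (isRecursive_differFormula χ) fun s hs => by
    classical
    choose! g hg using fun φ (hφ : φ ∈ s) => hs hφ
    obtain ⟨a, hau, ha⟩ := hcon (s.image g)
    obtain ⟨b, hb⟩ := exists_realize_of_elementaryEmbedding e
      (BoundedFormula.iInf fun φ : s => φ.1) u (a := a) <| by
      refine BoundedFormula.realize_iInf.2 fun φ => ?_
      have := mt (hagree (g φ.1) a hau).1 (ha _ (Finset.mem_image_of_mem g φ.2))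
      rw [not_not, hg φ.1 φ.2] at this
      exact this
    refine ⟨b, fun φ hφ => ?_⟩
    rw [hcons]
    exact BoundedFormula.realize_iInf.1 hb ⟨φ, hφ⟩
  have ha' : ∀ φ, (differFormula χ φ).Realize ![e a, e u] := fun φ => by
    have := ha _ ⟨φ, rfl⟩
    rw [hcons, ← e.map_formula, ← hcomp] at this
    exact this
  -- Every formula of the type contains the bound, so any choice such as `⊥` will do.
  have hau : lt (e a) (e u) := ((realize_differFormula _ _ _).1 (ha' ⊥)).1
  -- The formula defining `X` below `a` over `a` is among those that should fail.
  obtain ⟨φ, hφ⟩ := exists_formula_of_definable_singleton (hX (e a))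
  refine (not_not.2 (ha' φ)) ((hagree φ _ hau).2 fun x hx => ?_)
  rw [mem_ofPred_eq, hφ, mem_ofPred_eq, and_iff_left hx]

end Saturation

/-! ### Neutral classes are 0-definable -/

section Main

variable {M N : Type*} [LPA.Structure M] [LPA.Structure N]

/-- The language is left open so as to cover both `LPA` with an initial part of `X` and the
expansion with `X` itself. -/
theorem definable_agreeBelow_realize {L : FirstOrder.Language.{0, 0}} [L.Structure N] {A Y : Set N}
    (hlt : ∀ i j : Option (Fin 1), A.Definable L {v : Option (Fin 1) → N | lt (v i) (v j)})
    (hφ : ∀ φ : LPA.BoundedFormula (Fin 1) 1, ∀ i j : Option (Fin 1),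
      A.Definable L {v : Option (Fin 1) → N | φ.Realize (fun _ => v i) fun _ => v j})
    (hY : A.Definable₁ L Y) (φ : LPA.BoundedFormula (Fin 1) 1) :
    A.Definable L {v : Fin 1 → N |
      AgreeBelow lt Y {x | φ.Realize (fun _ => v 0) fun _ => x} (v 0)} :=
  definable_all <| definable_imp (hlt _ _) <| definable_iff (definable_mem hY none) (hφ φ _ _)

theorem IsNeutralClass.isZeroDefinable (hN : N ⊨ PA) (e : M ↪ₑ[LPA] N)
    (hsat : RecursivelySaturated M) {X : Set N} (hX : IsNeutralClass X) : IsZeroDefinable X := by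
  obtain ⟨hC, hneut⟩ := hX
  obtain ⟨u, hu⟩ := exists_gt_definable hN e hsat
  obtain ⟨s, hs⟩ := exists_finite_formulas e hsat hN (hC.definable_singleton hN hneut) u
  have hall : ∀ a : N, ∃ φ : s, AgreeBelow lt X {x | φ.1.Realize (fun _ => a) fun _ => x} a := by
    by_contra! hcon
    obtain ⟨b, hb⟩ := hcon
    -- A failure of all formulas in `s` yields one that is 0-definable, hence below `u`, where `s`
    -- suffices.
    obtain ⟨c, hc, hc0⟩ := exists_mem_dcl hN hneut (a := zeroElem N) (b := b)
      (P := fun a => ∀ φ : s, ¬ AgreeBelow lt X {x | φ.1.Realize (fun _ => a) fun _ => x} a) hb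
      (by
        have hle : (univ : Set N).Definable LPA {v : Fin 1 → N | lt (v 0) b ∨ v 0 = b} :=
          definable_const (P := fun v b => lt (v 0) b ∨ v 0 = b) _
            ((definable_lt _ _).union (definable_eq _ _))
        have := definable_and (definable_finite_all fun φ : s => definable_not <|
          definable_agreeBelow_realize (fun i j => definable_lt i j)
            (fun φ i j => definable_realize φ (fun _ => i) fun _ => j) (hC b) φ.1) hle
        -- Up to `b`, failure depends only on `X` below `b`, which is definable.
        refine definable_congr this fun v => and_congr_left fun hv => ?_
        refine forall_congr' fun φ => not_congr <| forall_congr' fun x => imp_congr_right fun hx => ?_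
        have hxb : lt x b := by
          rcases hv with h | h
          · exact lt_trans' hN hx h
          · exact h ▸ hx
        rw [mem_ofPred_eq, and_iff_left hxb])
      (by
        let := unaryStructure X
        exact definable_finite_all (L := LPA.sum LUnary) fun φ : s => definable_not <|
          definable_agreeBelow_realize (L := LPA.sum LUnary)
            (fun i j => DefinableIn.of_definable (definable_lt i j))
            (fun φ i j => DefinableIn.of_definable (definable_realize φ (fun _ => i) fun _ => j))
            (definableIn_mem 0) φ.1)
    obtain ⟨φ, hφs, hφ⟩ := hs c (hu c (definable_empty_of_definable_zero hc0))
    exact hc ⟨φ, hφs⟩ hφ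
  exact isZeroDefinable_of_isDefinable hN hneut <| hC.isDefinable_of_finite_width hN
    (S := fun (φ : s) a => {x | φ.1.Realize (fun _ => a) fun _ => x})
    (fun φ => definable_realize φ.1 (fun _ => 0) fun _ => 1) hall

end Main

end PAModels

theorem corollary2 {N : Type*} [PAModels.LPA.Structure N] (hN : N ⊨ PAModels.PA) :
    ((∃ M : PAModels.LPA.ElementarySubstructure N, PAModels.RecursivelySaturated M) →
      ∀ X : Set N, PAModels.IsClass X →
        (PAModels.IsNeutralClass X ↔ PAModels.IsZeroDefinable X)) ∧
    (PAModels.RecursivelySaturated N → ¬ PAModels.NeutrallyExpandable N) := by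
  refine ⟨fun ⟨M, hM⟩ X _ => ⟨fun hX => hX.isZeroDefinable hN M.subtype hM,
    fun hX => hX.isNeutralClass⟩, ?_⟩
  rintro hsat ⟨X, hX, hdef⟩
  exact hdef ((hX.isZeroDefinable hN (.refl PAModels.LPA N) hsat).mono (Set.empty_subset _))
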